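/- Let $\mathcal H$ be a separable complex Hilbert space and let $\rho$ be a state (density operator) on $\mathcal H\otimes\mathcal H$. Write $\mathrm{tr}^{(k)}[T]$ for the partial trace of a trace class operator $T$ on $\mathcal H\otimes\mathcal H\otimes\mathcal H$ over the $k$-th factor. Say that $\rho$ is a DSO state if there is a positive trace class operator $T$ on $\mathcal H\otimes\mathcal H\otimes\mathcal H$ (a density source-operator for $\rho$) such that $\mathrm{tr}^{(1)}[T]=\mathrm{tr}^{(2)}[T]=\rho$ or $\mathrm{tr}^{(2)}[T]=\mathrm{tr}^{(3)}[T]=\rho$; that a DSO state $\rho$ is of the Bell class if there is a positive trace class operator $T$ with $\mathrm{tr}^{(1)}[T]=\mathrm{tr}^{(2)}[T]=\mathrm{tr}^{(3)}[T]=\rho$; and that $\rho$ is symmetric if $V\rho V=\rho$, where $V(\psi_1\otimes\psi_2)=\psi_2\otimes\psi_1$. Let $\gamma_{nm}$, $n,m=1,2$, be real coefficients with $|\gamma_{nm}|\le 1$ such that $\gamma_{11}\gamma_{12}=-\gamma_{21}\gamma_{22}$ or $\gamma_{11}\gamma_{21}=-\gamma_{12}\gamma_{22}$. If a DSO state $\rho$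 on $\mathcal H\otimes\mathcal H$ is either symmetric or of the Bell class, then $$\Bigl|\sum_{n,m=1,2}\gamma_{nm}\,\langle\lambda_1\lambda_2\rangle_\rho^{(a_n,b_m)}\Bigr|\le 2$$ for all generalized quantum measurements of Alice and Bob with real outcomes of any type bounded by $1$ in absolute value. That is: Alice's settings $a_1,a_2$ and Bob's settings $b_1,b_2$ are described by normalized positive operator-valued measures $M_1^{(a_n)}$ and $M_2^{(b_m)}$ on $\mathcal H$ with outcome sets $\Lambda_1^{(n)},\Lambda_2^{(m)}\subseteq[-1,1]$, the joint measurement with settings $(a_n,b_m)$ is described by the positive operator-valued measure $M^{(a_n,b_m)}$ on $\Lambda_1^{(n)}\times\Lambda_2^{(m)}$ with $M^{(a_n,b_m)}(B_1\times B_2)=M_1^{(a_n)}(B_1)\otimes M_2^{(b_m)}(B_2)$ for all measurable $B_1,B_2$, and $$\langle\lambda_1\lambda_2\rangle_\rho^{(a_n,b_m)}=\int_{\Lambda_1^{(n)}\times\Lambda_2^{(m)}}\lambda_1\lambda_2\,\mathrm{tr}\bigl[\rho\,M^{(a_n,b_m)}(d\lambda_1\times d\lambda_2)\bigr].$$ 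-/

import Mathlib

open scoped TensorProduct ENNReal InnerProductSpace

noncomputable section

namespace QuantumBell

/-! ### Hilbert tensor products -/

section TensorProducts

variable (H K L : Type*)
  [NormedAddCommGroup H] [InnerProductSpace ℂ H]
  [NormedAddCommGroup K] [InnerProductSpace ℂ K]
  [NormedAddCommGroup L] [InnerProductSpace ℂ L]

/-- The Hilbert space tensor product of `H` and `K`: the completion of the algebraic tensor
product for the inner product `⟪x ⊗ y, x' ⊗ y'⟫ = ⟪x, x'⟫ * ⟪y, y'⟫`. -/
abbrev HTensor : Type _ := UniformSpace.Completion (H ⊗[ℂ] K)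

/-- The threefold Hilbert tensor product. -/
abbrev HTensor₃ : Type _ := HTensor (HTensor H K) L

variable {H K L}

/-- The elementary tensor `x ⊗ y` in the Hilbert tensor product. -/
def tmul (x : H) (y : K) : HTensor H K := ((x ⊗ₜ[ℂ] y : H ⊗[ℂ] K) : HTensor H K)

/-- The elementary tensor `x ⊗ y ⊗ z`. -/
def tmul₃ (x : H) (y : K) (z : L) : HTensor₃ H K L := tmul (tmul x y) z

/-- The tensor product `A ⊗ B` of bounded operators. -/
def tensorOp (A : H →L[ℂ] H) (B : K →L[ℂ] K) : HTensor H K →L[ℂ] HTensor H K :=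
  (TensorProduct.mapL A B).completion

variable (H) in
/-- The permutation operator `V (x ⊗ y) = y ⊗ x`. -/
def swapOp : HTensor H H →L[ℂ] HTensor H H :=
  ((TensorProduct.commIsometry ℂ H H).toContinuousLinearEquiv :
    H ⊗[ℂ] H →L[ℂ] H ⊗[ℂ] H).completion

end TensorProducts

/-! ### Trace class operators, traces, density operators -/

section Trace

variable (H : Type*) [NormedAddCommGroup H] [InnerProductSpace ℂ H] [CompleteSpace H]

/-- The index set of an orthonormal basis of `H`. -/
def BasisIndex : Set H := (exists_hilbertBasis ℂ H).choose

/-- An orthonormal basis of `H`, fixed once and for all. The notions below that use it do not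
depend on which basis is taken. -/
def stdBasis : HilbertBasis (BasisIndex H) ℂ H :=
  (exists_hilbertBasis ℂ H).choose_spec.choose

variable {H}

/-- `T` is of trace class: `tr |T| < ∞`, where `|T| = (T† T) ^ (1 / 2)`. -/
def IsTraceClass (T : H →L[ℂ] H) : Prop :=
  Summable fun i : BasisIndex H => (⟪stdBasis H i, CFC.abs T (stdBasis H i)⟫_ℂ).re

/-- The trace of a (trace class) operator. -/
def trace (T : H →L[ℂ] H) : ℂ :=
  ∑' i : BasisIndex H, ⟪stdBasis H i, T (stdBasis H i)⟫_ℂ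

/-- Density operators, i.e. (normal) quantum states. -/
structure IsDensityOperator (ρ : H →L[ℂ] H) : Prop where
  isPositive : ρ.IsPositive
  isTraceClass : IsTraceClass ρ
  trace_eq_one : trace ρ = 1

end Trace

/-! ### Partial traces over one place of a threefold tensor product

An operator on a twofold tensor product is determined by its matrix elements between elementary
tensors; the partial trace sums the matrix elements of `T` over an orthonormal basis of the
factor that is traced out. -/

section PartialTrace

/-- The partial trace of `T` over the first place is `σ`. -/
def IsPartialTrace₁ {H₁ H₂ H₃ : Type*}
    [NormedAddCommGroup H₁] [InnerProductSpace ℂ H₁] [CompleteSpace H₁]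
    [NormedAddCommGroup H₂] [InnerProductSpace ℂ H₂]
    [NormedAddCommGroup H₃] [InnerProductSpace ℂ H₃]
    (T : HTensor₃ H₁ H₂ H₃ →L[ℂ] HTensor₃ H₁ H₂ H₃)
    (σ : HTensor H₂ H₃ →L[ℂ] HTensor H₂ H₃) : Prop :=
  ∀ (x x' : H₂) (y y' : H₃),
    HasSum (fun i : BasisIndex H₁ =>
        ⟪tmul₃ (stdBasis H₁ i) x y, T (tmul₃ (stdBasis H₁ i) x' y')⟫_ℂ)
      ⟪tmul x y, σ (tmul x' y')⟫_ℂ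

/-- The partial trace of `T` over the second place is `σ`. -/
def IsPartialTrace₂ {H₁ H₂ H₃ : Type*}
    [NormedAddCommGroup H₁] [InnerProductSpace ℂ H₁]
    [NormedAddCommGroup H₂] [InnerProductSpace ℂ H₂] [CompleteSpace H₂]
    [NormedAddCommGroup H₃] [InnerProductSpace ℂ H₃]
    (T : HTensor₃ H₁ H₂ H₃ →L[ℂ] HTensor₃ H₁ H₂ H₃)
    (σ : HTensor H₁ H₃ →L[ℂ] HTensor H₁ H₃) : Prop :=
  ∀ (x x' : H₁) (y y' : H₃),
    HasSum (fun i : BasisIndex H₂ =>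
        ⟪tmul₃ x (stdBasis H₂ i) y, T (tmul₃ x' (stdBasis H₂ i) y')⟫_ℂ)
      ⟪tmul x y, σ (tmul x' y')⟫_ℂ

/-- The partial trace of `T` over the third place is `σ`. -/
def IsPartialTrace₃ {H₁ H₂ H₃ : Type*}
    [NormedAddCommGroup H₁] [InnerProductSpace ℂ H₁]
    [NormedAddCommGroup H₂] [InnerProductSpace ℂ H₂]
    [NormedAddCommGroup H₃] [InnerProductSpace ℂ H₃] [CompleteSpace H₃]
    (T : HTensor₃ H₁ H₂ H₃ →L[ℂ] HTensor₃ H₁ H₂ H₃)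
    (σ : HTensor H₁ H₂ →L[ℂ] HTensor H₁ H₂) : Prop :=
  ∀ (x x' : H₁) (y y' : H₂),
    HasSum (fun i : BasisIndex H₃ =>
        ⟪tmul₃ x y (stdBasis H₃ i), T (tmul₃ x' y' (stdBasis H₃ i))⟫_ℂ)
      ⟪tmul x y, σ (tmul x' y')⟫_ℂ

end PartialTrace

/-! ### Source-operators, DSO states, Bell class states -/

section SourceOperators

variable {H₁ H₂ : Type*}
  [NormedAddCommGroup H₁] [InnerProductSpace ℂ H₁] [CompleteSpace H₁]
  [NormedAddCommGroup H₂] [InnerProductSpace ℂ H₂] [CompleteSpace H₂]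

/-- Source-operators on `H₁ ⊗ H₁ ⊗ H₂` for `ρ`. -/
structure IsSourceOperator₁₁₂ (ρ : HTensor H₁ H₂ →L[ℂ] HTensor H₁ H₂)
    (T : HTensor₃ H₁ H₁ H₂ →L[ℂ] HTensor₃ H₁ H₁ H₂) : Prop where
  isSelfAdjoint : IsSelfAdjoint T
  isTraceClass : IsTraceClass T
  partialTrace₁ : IsPartialTrace₁ T ρ
  partialTrace₂ : IsPartialTrace₂ T ρ

/-- Source-operators on `H₁ ⊗ H₂ ⊗ H₂` for `ρ`. -/
structure IsSourceOperator₁₂₂ (ρ : HTensor H₁ H₂ →L[ℂ] HTensor H₁ H₂)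
    (T : HTensor₃ H₁ H₂ H₂ →L[ℂ] HTensor₃ H₁ H₂ H₂) : Prop where
  isSelfAdjoint : IsSelfAdjoint T
  isTraceClass : IsTraceClass T
  partialTrace₂ : IsPartialTrace₂ T ρ
  partialTrace₃ : IsPartialTrace₃ T ρ

/-- A state is a DSO state if it has a density (i.e. positive) source-operator, in one of the
two directions of dilation. -/
def IsDSOState (ρ : HTensor H₁ H₂ →L[ℂ] HTensor H₁ H₂) : Prop :=
  IsDensityOperator ρ ∧
    ((∃ T : HTensor₃ H₁ H₁ H₂ →L[ℂ] HTensor₃ H₁ H₁ H₂,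
        IsSourceOperator₁₁₂ ρ T ∧ T.IsPositive) ∨
      (∃ T : HTensor₃ H₁ H₂ H₂ →L[ℂ] HTensor₃ H₁ H₂ H₂,
        IsSourceOperator₁₂₂ ρ T ∧ T.IsPositive))

variable {H : Type*} [NormedAddCommGroup H] [InnerProductSpace ℂ H] [CompleteSpace H]

/-- A state on `H ⊗ H` is of the Bell class if it has a density source-operator on `H ⊗ H ⊗ H`
whose three partial traces are all equal to the state. -/
def IsBellClass (ρ : HTensor H H →L[ℂ] HTensor H H) : Prop :=
  IsDSOState ρ ∧ ∃ T : HTensor₃ H H H →L[ℂ] HTensor₃ H H H,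
    IsSourceOperator₁₁₂ ρ T ∧ IsSourceOperator₁₂₂ ρ T ∧ T.IsPositive

/-- A state on `H ⊗ H` is symmetric if it is invariant under the permutation of the factors. -/
def IsSymmetricState (ρ : HTensor H H →L[ℂ] HTensor H H) : Prop :=
  swapOp H * ρ * swapOp H = ρ

end SourceOperators

/-! ### Generalized quantum measurements -/

/-- A normalized positive operator-valued measure on `Λ`, with values in the bounded operators
on `H`. Countable additivity is in the weak operator topology. -/
structure POVM (Λ : Type*) [MeasurableSpace Λ] (H : Type*)
    [NormedAddCommGroup H] [InnerProductSpace ℂ H] [CompleteSpace H] where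
  /-- The operator assigned to an event. -/
  op : Set Λ → H →L[ℂ] H
  isPositive : ∀ B, MeasurableSet B → (op B).IsPositive
  op_empty : op ∅ = 0
  op_univ : op Set.univ = 1
  hasSum_op : ∀ s : ℕ → Set Λ, (∀ k, MeasurableSet (s k)) →
    Pairwise (fun j k => Disjoint (s j) (s k)) →
    ∀ x y : H, HasSum (fun k => ⟪x, op (s k) y⟫_ℂ) ⟪x, op (⋃ k, s k) y⟫_ℂ

/-- `M` describes a joint generalized measurement in which one party measures `M₁` on the first
factor and the other party `M₂` on the second one:
`M (B₁ × B₂) = M₁ B₁ ⊗ M₂ B₂` for all events `B₁`, `B₂`. -/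
def IsJointMeasurement {Λ₁ Λ₂ : Type*} [MeasurableSpace Λ₁] [MeasurableSpace Λ₂]
    {H₁ H₂ : Type*}
    [NormedAddCommGroup H₁] [InnerProductSpace ℂ H₁] [CompleteSpace H₁]
    [NormedAddCommGroup H₂] [InnerProductSpace ℂ H₂] [CompleteSpace H₂]
    (M₁ : POVM Λ₁ H₁) (M₂ : POVM Λ₂ H₂) (M : POVM (Λ₁ × Λ₂) (HTensor H₁ H₂)) : Prop :=
  ∀ (B₁ : Set Λ₁) (B₂ : Set Λ₂), MeasurableSet B₁ → MeasurableSet B₂ →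
    M.op (B₁ ×ˢ B₂) = tensorOp (M₁.op B₁) (M₂.op B₂)

section OutcomeMeasure

variable {H : Type*} [NormedAddCommGroup H] [InnerProductSpace ℂ H] [CompleteSpace H]

theorem IsDensityOperator.exists_sqrt {ρ : H →L[ℂ] H} (hρ : IsDensityOperator ρ) :
    ∃ C : H →L[ℂ] H, IsSelfAdjoint C ∧ C * C = ρ ∧
      Summable fun i : BasisIndex H => ‖C (stdBasis H i)‖ ^ 2 := by
  have h0 : 0 ≤ ρ := (ContinuousLinearMap.nonneg_iff_isPositive ρ).2 hρ.isPositive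
  have hC : IsSelfAdjoint (CFC.sqrt ρ) := (CFC.sqrt_nonneg ρ).isSelfAdjoint
  have hCC : CFC.sqrt ρ * CFC.sqrt ρ = ρ := CFC.sqrt_mul_sqrt_self ρ h0
  refine ⟨CFC.sqrt ρ, hC, hCC, ?_⟩
  have hs := hρ.isTraceClass
  unfold IsTraceClass at hs
  rw [CFC.abs_of_nonneg ρ h0] at hs
  refine hs.congr fun i => ?_
  set C := CFC.sqrt ρ
  rw [← hCC, mul_apply_eq_comp,
    ← ContinuousLinearMap.adjoint_inner_left,
    (ContinuousLinearMap.isSelfAdjoint_iff'.1 hC), inner_self_eq_norm_sq_to_K]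
  norm_cast

theorem hasSum_norm_inner_sq (x : H) :
    HasSum (fun i => ‖⟪stdBasis H i, x⟫_ℂ‖ ^ 2) (‖x‖ ^ 2) := by
  have h := Complex.hasSum_re ((stdBasis H).hasSum_inner_mul_inner x x)
  rw [inner_self_eq_norm_sq_to_K] at h
  have h1 : (((‖x‖ : ℝ) : ℂ) ^ 2).re = ‖x‖ ^ 2 := by norm_cast
  rw [← h1]
  refine h.congr_fun fun i => ?_
  rw [← inner_conj_symm x, ← Complex.normSq_eq_conj_mul_self, Complex.ofReal_re,
    Complex.normSq_eq_norm_sq]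

/-- `tr (C C X) = tr (C X C)` for a self-adjoint Hilbert-Schmidt operator `C`. -/
theorem hasSum_trace_sqrt {C : H →L[ℂ] H} (hC : IsSelfAdjoint C)
    (hs : Summable fun i : BasisIndex H => ‖C (stdBasis H i)‖ ^ 2) (X : H →L[ℂ] H) :
    HasSum (fun i : BasisIndex H => ⟪C (stdBasis H i), X (C (stdBasis H i))⟫_ℂ)
      (trace (C * C * X)) := by
  have hCs : ∀ x y : H, ⟪C x, y⟫_ℂ = ⟪x, C y⟫_ℂ := fun x y => by
    rw [← ContinuousLinearMap.adjoint_inner_right, ContinuousLinearMap.isSelfAdjoint_iff'.1 hC]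
  have key : ∀ (Y : H →L[ℂ] H), (Summable fun j => ‖Y (stdBasis H j)‖ ^ 2) →
      Summable fun p : BasisIndex H × BasisIndex H =>
        ‖⟪stdBasis H p.2, Y (stdBasis H p.1)⟫_ℂ‖ ^ 2 := fun Y hY => by
    have h0 : (0 : BasisIndex H × BasisIndex H → ℝ) ≤
        fun p => ‖⟪stdBasis H p.2, Y (stdBasis H p.1)⟫_ℂ‖ ^ 2 := fun p => sq_nonneg _
    rw [summable_prod_of_nonneg h0]
    refine ⟨fun j => (hasSum_norm_inner_sq (Y (stdBasis H j))).summable, ?_⟩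
    simpa only [(hasSum_norm_inner_sq _).tsum_eq] using hY
  set Y : H →L[ℂ] H := X.adjoint * C with hYdef
  have hY : Summable fun j => ‖Y (stdBasis H j)‖ ^ 2 := by
    refine Summable.of_nonneg_of_le (fun _ => by positivity) (fun j => ?_)
      (hs.mul_left (‖X.adjoint‖ ^ 2))
    rw [← mul_pow]
    exact pow_le_pow_left₀ (norm_nonneg _) (X.adjoint.le_opNorm _) 2
  -- the double series over matrix elements converges absolutely
  let F : BasisIndex H × BasisIndex H → ℂ := fun p =>
    ⟪Y (stdBasis H p.1), stdBasis H p.2⟫_ℂ * ⟪stdBasis H p.2, C (stdBasis H p.1)⟫_ℂ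
  have hF : Summable F := by
    refine Summable.of_norm_bounded ((key Y hY).add (key C hs)) fun p => ?_
    simp only [F, norm_mul]
    rw [norm_inner_symm]
    nlinarith [sq_nonneg (‖⟪stdBasis H p.2, Y (stdBasis H p.1)⟫_ℂ‖
      - ‖⟪stdBasis H p.2, C (stdBasis H p.1)⟫_ℂ‖),
      sq_nonneg (‖⟪stdBasis H p.2, Y (stdBasis H p.1)⟫_ℂ‖),
      sq_nonneg (‖⟪stdBasis H p.2, C (stdBasis H p.1)⟫_ℂ‖)]
  have hrow : ∀ j, HasSum (fun i => F (j, i))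
      ⟪C (stdBasis H j), X (C (stdBasis H j))⟫_ℂ := fun j => by
    have h := (stdBasis H).hasSum_inner_mul_inner (Y (stdBasis H j)) (C (stdBasis H j))
    have h1 : ⟪Y (stdBasis H j), C (stdBasis H j)⟫_ℂ
        = ⟪C (stdBasis H j), X (C (stdBasis H j))⟫_ℂ := by
      rw [hYdef, mul_apply_eq_comp, ContinuousLinearMap.adjoint_inner_left]
    rwa [h1] at h
  have hcol : ∀ i, HasSum (fun j => F (j, i))
      ⟪stdBasis H i, (C * C * X) (stdBasis H i)⟫_ℂ := fun i => by
    have h := (stdBasis H).hasSum_inner_mul_inner (C (stdBasis H i)) (C (X (stdBasis H i)))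
    have h1 : ⟪C (stdBasis H i), C (X (stdBasis H i))⟫_ℂ
        = ⟪stdBasis H i, (C * C * X) (stdBasis H i)⟫_ℂ := by
      rw [hCs]; rfl
    rw [h1] at h
    refine h.congr_fun fun j => ?_
    simp only [F, hYdef]
    rw [mul_apply_eq_comp, ContinuousLinearMap.adjoint_inner_left, hCs, hCs, mul_comm]
  have h1 := hF.hasSum.prod_fiberwise hrow
  have h2 : HasSum (F ∘ Prod.swap) (∑' p, F p) :=
    (Equiv.prodComm (BasisIndex H) (BasisIndex H)).hasSum_iff.2 hF.hasSum
  have h3 := h2.prod_fiberwise (fun i => hcol i)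
  rw [show trace (C * C * X) = ∑' p, F p from h3.tsum_eq]
  exact h1

/-- The distribution `B ↦ tr (ρ M(B))` of the outcomes of the measurement `M` in the state `ρ`. -/
def outcomeMeasure {Λ : Type*} [MeasurableSpace Λ] (ρ : H →L[ℂ] H) (hρ : IsDensityOperator ρ)
    (M : POVM Λ H) : MeasureTheory.Measure Λ :=
  MeasureTheory.Measure.ofMeasurable
    (fun B _ => ENNReal.ofReal (trace (ρ * M.op B)).re)
    (by simp [M.op_empty, trace])
    (by
      intro s hsm hd
      obtain ⟨C, hC, rfl, hs⟩ := hρ.exists_sqrt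
      have hval : ∀ B, MeasurableSet B → ENNReal.ofReal (trace (C * C * M.op B)).re
          = ∑' i : BasisIndex H,
            ENNReal.ofReal (⟪C (stdBasis H i), M.op B (C (stdBasis H i))⟫_ℂ).re := by
        intro B hB
        have h := Complex.hasSum_re (hasSum_trace_sqrt hC hs (M.op B))
        rw [← h.tsum_eq]
        exact ENNReal.ofReal_tsum_of_nonneg
          (fun i => (M.isPositive B hB).re_inner_nonneg_right _) h.summable
      rw [hval _ (MeasurableSet.iUnion hsm)]
      simp_rw [fun k => hval _ (hsm k)]
      rw [ENNReal.tsum_comm]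
      refine tsum_congr fun i => ?_
      have h := Complex.hasSum_re (M.hasSum_op s hsm hd (C (stdBasis H i)) (C (stdBasis H i)))
      rw [← h.tsum_eq]
      exact ENNReal.ofReal_tsum_of_nonneg
        (fun k => (M.isPositive _ (hsm k)).re_inner_nonneg_right _) h.summable)

end OutcomeMeasure

/-- The expectation value `⟨λ₁ λ₂⟩` of the product of the outcomes of the joint measurement `M`,
with real outcomes `λ₁ ∈ Λ₁` and `λ₂ ∈ Λ₂`, in the state `ρ`. -/
def productExpectation {Λ₁ Λ₂ : Set ℝ} {H₁ H₂ : Type*}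
    [NormedAddCommGroup H₁] [InnerProductSpace ℂ H₁]
    [NormedAddCommGroup H₂] [InnerProductSpace ℂ H₂]
    (ρ : HTensor H₁ H₂ →L[ℂ] HTensor H₁ H₂) (hρ : IsDensityOperator ρ)
    (M : POVM (Λ₁ × Λ₂) (HTensor H₁ H₂)) : ℝ :=
  ∫ x : Λ₁ × Λ₂, (x.1 : ℝ) * (x.2 : ℝ) ∂(outcomeMeasure ρ hρ M)

end QuantumBell

end

namespace QuantumBell

/-! ### Tensor products of operators -/

section TensorOperators

open UniformSpace

variable {H K : Type*}
  [NormedAddCommGroup H] [InnerProductSpace ℂ H]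
  [NormedAddCommGroup K] [InnerProductSpace ℂ K]

/-! A source-operator `T` with its first two partial traces equal to `ρ` makes room for both of
Alice's settings at once. The functional `F X Y Z = tr (T (X ⊗ Y ⊗ Z))` is positive, and the
correlations of `A₀` and `A₁` with `B` are `F A₀ 1 B` and `F 1 A₁ B`. In the doubled factors, 2 (A₀
⊗ 1 ± 1 ⊗ A₁) = (1 + A₀) ⊗ (1 ± A₁) - (1 - A₀) ⊗ (1 ∓ A₁), a difference of positive operators when
`-1 ≤ Aₙ ≤ 1`. For positive `X`, `Y` and `-1 ≤ B ≤ 1`, positivity of `F` gives `|F X Y B| ≤ F X Y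
1`. The sum over both settings of Bob is thereby bounded by a convex combination of `|γ₀₀ + γ₁₀| +
|γ₀₁ + γ₁₁|` and `|γ₀₀ - γ₁₀| + |γ₀₁ - γ₁₁|`. Each is at most 2 by the relation between the
coefficients (`abs_add_add_abs_add_le_two`). This is `IsDilation.abs_sum_le_two`.

The other relation is the first one for the transposed coefficients and needs Bob's factor doubled.
Symmetry of `ρ` or the Bell class property supplies a dilation on either side
(`IsDSOState.exists_isDilation`).

Two analytic facts connect this with the definitions. The `trace_mul_tensorOp` lemmas turn partial
traces, given by matrix elements, into identities between trace functionals.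
`tendsto_re_trace_simpleOp` presents an expectation as a limit of traces with operators between -1
and 1, so no operator integral is needed. -/

theorem inner_tmul_tmul (x x' : H) (y y' : K) :
    ⟪tmul x y, tmul x' y'⟫_ℂ = ⟪x, x'⟫_ℂ * ⟪y, y'⟫_ℂ := by
  simp [tmul]

theorem tensorOp_tmul (A : H →L[ℂ] H) (B : K →L[ℂ] K) (x : H) (y : K) :
    tensorOp A B (tmul x y) = tmul (A x) (B y) := by
  simp [tensorOp, tmul]

theorem swapOp_tmul (x y : H) : swapOp H (tmul x y) = tmul y x := by
  rw [swapOp, tmul, ContinuousLinearMap.completion_apply_coe]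
  rfl

/-- Fixing the right factor of an elementary tensor. -/
noncomputable def tmulRight (y : K) : H →L[ℂ] HTensor H K :=
  Completion.toComplL ∘L (TensorProduct.mkL ℂ H K).flip y

/-- Fixing the left factor of an elementary tensor. -/
noncomputable def tmulLeft (x : H) : K →L[ℂ] HTensor H K :=
  Completion.toComplL ∘L TensorProduct.mkL ℂ H K x

theorem tmulRight_apply (x : H) (y : K) : tmulRight y x = tmul x y := rfl

theorem tmulLeft_apply (x : H) (y : K) : tmulLeft x y = tmul x y := rfl

/-- Continuous linear maps out of the Hilbert tensor product agree if they agree on elementary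
tensors. -/
theorem HTensor.ext {E : Type*} [NormedAddCommGroup E] [NormedSpace ℂ E]
    {f g : HTensor H K →L[ℂ] E} (h : ∀ x y, f (tmul x y) = g (tmul x y)) : f = g := by
  ext v
  induction v using Completion.induction_on with
  | hp => exact isClosed_eq f.continuous g.continuous
  | ih v =>
    have : (f ∘L Completion.toComplL).toLinearMap = (g ∘L Completion.toComplL).toLinearMap :=
      TensorProduct.ext' fun x y => h x y
    exact LinearMap.congr_fun this v

theorem tensorOp_one : tensorOp (1 : H →L[ℂ] H) (1 : K →L[ℂ] K) = 1 :=
  HTensor.ext fun x y => by rw [tensorOp_tmul]; rfl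

theorem tensorOp_mul (A A' : H →L[ℂ] H) (B B' : K →L[ℂ] K) :
    tensorOp (A * A') (B * B') = tensorOp A B * tensorOp A' B' :=
  HTensor.ext fun x y => by
    rw [mul_apply_eq_comp, tensorOp_tmul, tensorOp_tmul, tensorOp_tmul]; rfl

variable (H K) in
/-- `tensorOp` as a bilinear map. -/
noncomputable def tensorOpₗ : (H →L[ℂ] H) →ₗ[ℂ] (K →L[ℂ] K) →ₗ[ℂ] (HTensor H K →L[ℂ] HTensor H K) :=
  LinearMap.mk₂ ℂ tensorOp
    (fun A A' B => HTensor.ext fun x y => by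
      simp only [add_apply, tensorOp_tmul]
      simp only [← tmulRight_apply, map_add])
    (fun c A B => HTensor.ext fun x y => by
      simp only [smul_apply, tensorOp_tmul]
      simp only [← tmulRight_apply, map_smul])
    (fun A B B' => HTensor.ext fun x y => by
      simp only [add_apply, tensorOp_tmul]
      simp only [← tmulLeft_apply, map_add])
    (fun c A B => HTensor.ext fun x y => by
      simp only [smul_apply, tensorOp_tmul]
      simp only [← tmulLeft_apply, map_smul])

theorem tensorOpₗ_apply (A : H →L[ℂ] H) (B : K →L[ℂ] K) :
    tensorOpₗ H K A B = tensorOp A B := rfl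

variable [CompleteSpace H] [CompleteSpace K]

omit [CompleteSpace H] [CompleteSpace K] in
/-- Self-adjointness can be checked on elementary tensors. -/
theorem HTensor.isSelfAdjoint_of_tmul {S : HTensor H K →L[ℂ] HTensor H K}
    (h : ∀ x x' y y', ⟪S (tmul x y), tmul x' y'⟫_ℂ = ⟪tmul x y, S (tmul x' y')⟫_ℂ) :
    IsSelfAdjoint S := by
  rw [ContinuousLinearMap.isSelfAdjoint_iff']
  refine HTensor.ext fun x y => ext_inner_left ℂ fun v => ?_
  rw [ContinuousLinearMap.adjoint_inner_right]
  have hS : innerSL ℂ (tmul x y) ∘L S = innerSL ℂ (S (tmul x y)) :=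
    HTensor.ext fun x' y' => (h x x' y y').symm
  simpa using congrArg (starRingEnd ℂ) (DFunLike.congr_fun hS v)

theorem tensorOp_isSelfAdjoint {A : H →L[ℂ] H} {B : K →L[ℂ] K} (hA : IsSelfAdjoint A)
    (hB : IsSelfAdjoint B) : IsSelfAdjoint (tensorOp A B) := by
  have hA' := ContinuousLinearMap.isSelfAdjoint_iff_isSymmetric.1 hA
  have hB' := ContinuousLinearMap.isSelfAdjoint_iff_isSymmetric.1 hB
  refine HTensor.isSelfAdjoint_of_tmul fun x x' y y' => ?_
  rw [tensorOp_tmul, tensorOp_tmul, inner_tmul_tmul, inner_tmul_tmul]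
  exact congrArg₂ (· * ·) (hA' x x') (hB' y y')

omit [CompleteSpace H] in
theorem swapOp_isSelfAdjoint : IsSelfAdjoint (swapOp H) :=
  HTensor.isSelfAdjoint_of_tmul fun x x' y y' => by
    rw [swapOp_tmul, swapOp_tmul, inner_tmul_tmul, inner_tmul_tmul, mul_comm]

theorem exists_isSelfAdjoint_mul_self {A : H →L[ℂ] H} (hA : 0 ≤ A) :
    ∃ a : H →L[ℂ] H, IsSelfAdjoint a ∧ a * a = A :=
  ⟨CFC.sqrt A, (CFC.sqrt_nonneg A).isSelfAdjoint, CFC.sqrt_mul_sqrt_self A hA⟩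

theorem mul_self_nonneg_of_isSelfAdjoint {A : H →L[ℂ] H} (hA : IsSelfAdjoint A) : 0 ≤ A * A := by
  simpa [hA.star_eq] using star_mul_self_nonneg A

/-- Square roots turn `A ⊗ B` into the square of the self-adjoint operator `a ⊗ b`. -/
theorem tensorOp_nonneg {A : H →L[ℂ] H} {B : K →L[ℂ] K} (hA : 0 ≤ A) (hB : 0 ≤ B) :
    0 ≤ tensorOp A B := by
  obtain ⟨a, ha, rfl⟩ := exists_isSelfAdjoint_mul_self hA
  obtain ⟨b, hb, rfl⟩ := exists_isSelfAdjoint_mul_self hB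
  rw [tensorOp_mul]
  exact mul_self_nonneg_of_isSelfAdjoint (tensorOp_isSelfAdjoint ha hb)

omit [CompleteSpace H] [CompleteSpace K] in
/-- The product of two Hilbert bases. -/
noncomputable def prodBasis {ι κ : Type*} (b : HilbertBasis ι ℂ H) (c : HilbertBasis κ ℂ K) :
    HilbertBasis (ι × κ) ℂ (HTensor H K) :=
  HilbertBasis.mkOfOrthogonalEqBot (v := fun p : ι × κ => tmul (b p.1) (c p.2))
    (by
      classical
      rw [orthonormal_iff_ite]
      rintro ⟨i, j⟩ ⟨i', j'⟩
      rw [inner_tmul_tmul, orthonormal_iff_ite.1 b.orthonormal, orthonormal_iff_ite.1 c.orthonormal]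
      simp only [Prod.mk.injEq]
      split_ifs <;> simp_all)
    (by
      -- Totality: a vector orthogonal to all products of basis vectors is orthogonal to all
      -- elementary tensors, by density of the spans in one factor at a time.
      rw [Submodule.eq_bot_iff]
      intro v hv
      have h0 : ∀ i j, ⟪v, tmul (b i) (c j)⟫_ℂ = 0 := fun i j =>
        Submodule.mem_orthogonal' _ v |>.1 hv _ (Submodule.subset_span ⟨(i, j), rfl⟩)
      have hb := Submodule.dense_iff_topologicalClosure_eq_top.2 b.dense_span
      have hc := Submodule.dense_iff_topologicalClosure_eq_top.2 c.dense_span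
      have h1 : ∀ x j, ⟪v, tmul x (c j)⟫_ℂ = 0 := fun x j => by
        have : innerSL ℂ v ∘L tmulRight (c j) = (0 : H →L[ℂ] ℂ) :=
          ContinuousLinearMap.ext_on hb (by rintro _ ⟨i, rfl⟩; exact h0 i j)
        exact DFunLike.congr_fun this x
      have h2 : ∀ x y, ⟪v, tmul x y⟫_ℂ = 0 := fun x y => by
        have : innerSL ℂ v ∘L tmulLeft x = (0 : K →L[ℂ] ℂ) :=
          ContinuousLinearMap.ext_on hc (by rintro _ ⟨j, rfl⟩; exact h1 x j)
        exact DFunLike.congr_fun this y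
      have h3 : innerSL ℂ v = (0 : HTensor H K →L[ℂ] ℂ) := HTensor.ext h2
      exact inner_self_eq_zero.1 (DFunLike.congr_fun h3 v))

omit [CompleteSpace H] [CompleteSpace K] in
theorem prodBasis_apply {ι κ : Type*} (b : HilbertBasis ι ℂ H) (c : HilbertBasis κ ℂ K)
    (p : ι × κ) : prodBasis b c p = tmul (b p.1) (c p.2) := by
  simp [prodBasis]

end TensorOperators

/-! ### Traces of products with a positive trace class operator -/

section TraceFormula

variable {K : Type*} [NormedAddCommGroup K] [InnerProductSpace ℂ K] [CompleteSpace K]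

theorem exists_hilbertSchmidt_sqrt {T : K →L[ℂ] K} (hT : T.IsPositive) (ht : IsTraceClass T) :
    ∃ C : K →L[ℂ] K, IsSelfAdjoint C ∧ C * C = T ∧
      Summable fun i : BasisIndex K => ‖C (stdBasis K i)‖ ^ 2 := by
  have h0 : 0 ≤ T := (ContinuousLinearMap.nonneg_iff_isPositive T).2 hT
  obtain ⟨C, hC, rfl⟩ := exists_isSelfAdjoint_mul_self h0
  refine ⟨C, hC, rfl, ?_⟩
  unfold IsTraceClass at ht
  rw [CFC.abs_of_nonneg _ h0] at ht
  refine ht.congr fun i => ?_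
  rw [mul_apply_eq_comp, ← ContinuousLinearMap.adjoint_inner_left,
    ContinuousLinearMap.isSelfAdjoint_iff'.1 hC, inner_self_eq_norm_sq_to_K]
  norm_cast

omit [CompleteSpace K] in
theorem tsum_enorm_inner_sq {ι : Type*} (b : HilbertBasis ι ℂ K) (x : K) :
    ∑' i, ‖⟪b i, x⟫_ℂ‖ₑ ^ 2 = ‖x‖ₑ ^ 2 := by
  have h := Complex.hasSum_re (b.hasSum_inner_mul_inner x x)
  have h1 : (⟪x, x⟫_ℂ).re = ‖x‖ ^ 2 := by
    rw [inner_self_eq_norm_sq_to_K]; norm_cast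
  have h2 : HasSum (fun i => ‖⟪b i, x⟫_ℂ‖ ^ 2) (‖x‖ ^ 2) := by
    rw [← h1]
    refine h.congr_fun fun i => ?_
    rw [← inner_conj_symm x, ← Complex.normSq_eq_conj_mul_self, Complex.ofReal_re,
      Complex.normSq_eq_norm_sq]
  have h3 := ENNReal.ofReal_tsum_of_nonneg (fun i => sq_nonneg ‖⟪b i, x⟫_ℂ‖) h2.summable
  rw [h2.tsum_eq] at h3
  simpa only [ENNReal.ofReal_pow (norm_nonneg _), ofReal_norm] using h3.symm

/-- The Hilbert-Schmidt norms of an operator and of its adjoint are the same, in any basis. -/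
theorem tsum_enorm_sq_adjoint {ι κ : Type*} (b : HilbertBasis ι ℂ K) (c : HilbertBasis κ ℂ K)
    (D : K →L[ℂ] K) : ∑' i, ‖D (b i)‖ₑ ^ 2 = ∑' j, ‖D.adjoint (c j)‖ₑ ^ 2 := by
  -- Both sides are the double sum of the squared matrix elements of `D`; in `ℝ≥0∞` the order of
  -- summation is free, with no summability to check.
  simp_rw [← tsum_enorm_inner_sq c (D (b _)), ← tsum_enorm_inner_sq b (D.adjoint (c _))]
  rw [ENNReal.tsum_comm]
  refine tsum_congr fun j => tsum_congr fun i => ?_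
  rw [ContinuousLinearMap.adjoint_inner_right, ← ofReal_norm, norm_inner_symm, ofReal_norm]

theorem inner_apply_mul_self {S : K →L[ℂ] K} (hS : IsSelfAdjoint S) (x : K) :
    ⟪x, (S * S) x⟫_ℂ = ((‖S x‖ ^ 2 : ℝ) : ℂ) := by
  rw [mul_apply_eq_comp, ← ContinuousLinearMap.adjoint_inner_left,
    ContinuousLinearMap.isSelfAdjoint_iff'.1 hS, inner_self_eq_norm_sq_to_K]
  norm_cast

/-- `tr (T S²) = tr (S T S)`, the right-hand side being computed in an arbitrary basis. -/
theorem trace_mul_sq {T S : K →L[ℂ] K} (hT : T.IsPositive) (ht : IsTraceClass T)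
    (hS : IsSelfAdjoint S) {ι : Type*} (b : HilbertBasis ι ℂ K) :
    trace (T * (S * S))
      = ((∑' i, ENNReal.ofReal (⟪S (b i), T (S (b i))⟫_ℂ).re).toReal : ℂ) := by
  obtain ⟨C, hC, rfl, hs⟩ := exists_hilbertSchmidt_sqrt hT ht
  have h := hasSum_trace_sqrt hC hs (S * S)
  simp_rw [inner_apply_mul_self hS] at h
  have h' : HasSum (fun i => ‖S (C (stdBasis K i))‖ ^ 2) (trace (C * C * (S * S))).re := by
    simpa only [Complex.ofReal_re] using Complex.hasSum_re h
  have hr : trace (C * C * (S * S)) = ((trace (C * C * (S * S))).re : ℂ) :=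
    h.unique (Complex.hasSum_ofReal.2 h')
  -- The trace is the squared Hilbert-Schmidt norm of `S C`, the right-hand side that of `C S`, its
  -- adjoint.
  have hadj : ContinuousLinearMap.adjoint (S * C) = C * S := by
    rw [← ContinuousLinearMap.star_eq_adjoint, star_mul, hC.star_eq, hS.star_eq]
  have h1 : ∑' i, ENNReal.ofReal (⟪S (b i), (C * C) (S (b i))⟫_ℂ).re
      = ENNReal.ofReal (trace (C * C * (S * S))).re := by
    rw [← h'.tsum_eq, ENNReal.ofReal_tsum_of_nonneg (fun i => sq_nonneg _) h'.summable]
    simp_rw [inner_apply_mul_self hC, Complex.ofReal_re, ENNReal.ofReal_pow (norm_nonneg _),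
      ofReal_norm]
    have := tsum_enorm_sq_adjoint (stdBasis K) b (S * C)
    rw [hadj] at this
    exact this.symm
  rw [h1, ENNReal.toReal_ofReal (by rw [← h'.tsum_eq]; exact tsum_nonneg fun i => sq_nonneg _),
    ← hr]

theorem re_trace_mul_nonneg {T X : K →L[ℂ] K} (hT : T.IsPositive) (ht : IsTraceClass T)
    (hX : 0 ≤ X) : 0 ≤ (trace (T * X)).re := by
  obtain ⟨S, hS, rfl⟩ := exists_isSelfAdjoint_mul_self hX
  rw [trace_mul_sq hT ht hS (stdBasis K), Complex.ofReal_re]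
  exact ENNReal.toReal_nonneg

/-- The functional `X ↦ tr (T X)`. -/
noncomputable def traceMul (T : K →L[ℂ] K) (hT : T.IsPositive) (ht : IsTraceClass T) :
    (K →L[ℂ] K) →ₗ[ℂ] ℂ where
  toFun X := trace (T * X)
  map_add' X Y := by
    -- `trace` is a bare `tsum`; the form `tr (C X C)` provides the convergence that additivity
    -- requires.
    obtain ⟨C, hC, rfl, hs⟩ := exists_hilbertSchmidt_sqrt hT ht
    refine (hasSum_trace_sqrt hC hs (X + Y)).unique ?_
    simpa only [add_apply, inner_add_right] using
      (hasSum_trace_sqrt hC hs X).add (hasSum_trace_sqrt hC hs Y)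
  map_smul' c X := by
    obtain ⟨C, hC, rfl, hs⟩ := exists_hilbertSchmidt_sqrt hT ht
    refine (hasSum_trace_sqrt hC hs (c • X)).unique ?_
    simpa only [smul_apply, inner_smul_right] using!
      (hasSum_trace_sqrt hC hs X).mul_left c

theorem traceMul_apply {T : K →L[ℂ] K} (hT : T.IsPositive) (ht : IsTraceClass T)
    (X : K →L[ℂ] K) : traceMul T hT ht X = trace (T * X) := rfl

/-- Two traces agree if, in some bases, one of them results from the other by summing over a part
of the indices. -/
theorem trace_mul_sq_eq_of_hasSum {K' : Type*} [NormedAddCommGroup K'] [InnerProductSpace ℂ K']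
    [CompleteSpace K'] {T S : K →L[ℂ] K} (hT : T.IsPositive) (ht : IsTraceClass T)
    (hS : IsSelfAdjoint S) {ρ R : K' →L[ℂ] K'} (hρ : ρ.IsPositive) (hρt : IsTraceClass ρ)
    (hR : IsSelfAdjoint R) {ι κ μ : Type*} (b : HilbertBasis μ ℂ K) (c : HilbertBasis κ ℂ K')
    (e : ι × κ ≃ μ)
    (h : ∀ j, HasSum (fun i => ⟪S (b (e (i, j))), T (S (b (e (i, j))))⟫_ℂ)
      ⟪R (c j), ρ (R (c j))⟫_ℂ) :
    trace (T * (S * S)) = trace (ρ * (R * R)) := by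
  rw [trace_mul_sq hT ht hS b, trace_mul_sq hρ hρt hR c, ← e.tsum_eq, ENNReal.tsum_prod',
    ENNReal.tsum_comm]
  refine congrArg (fun t : ℝ≥0∞ => (t.toReal : ℂ)) (tsum_congr fun j => ?_)
  have hj := Complex.hasSum_re (h j)
  rw [← hj.tsum_eq]
  exact (ENNReal.ofReal_tsum_of_nonneg
    (fun i => hT.re_inner_nonneg_right _) hj.summable).symm

end TraceFormula

end QuantumBell

namespace QuantumBell

/-! ### Partial traces as identities between functionals -/

section PartialTraceFunctional

variable {H₁ H₂ H₃ : Type*}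
  [NormedAddCommGroup H₁] [InnerProductSpace ℂ H₁] [CompleteSpace H₁]
  [NormedAddCommGroup H₂] [InnerProductSpace ℂ H₂] [CompleteSpace H₂]
  [NormedAddCommGroup H₃] [InnerProductSpace ℂ H₃] [CompleteSpace H₃]

/-- Bilinear functionals of two operators are determined by their values on positive operators. -/
theorem bilinear_ext_of_sq {f g : (H₁ →L[ℂ] H₁) →ₗ[ℂ] (H₂ →L[ℂ] H₂) →ₗ[ℂ] ℂ}
    (h : ∀ a b, IsSelfAdjoint a → IsSelfAdjoint b → f (a * a) (b * b) = g (a * a) (b * b)) :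
    f = g := by
  refine LinearMap.ext_on (CStarAlgebra.span_nonneg (A := H₁ →L[ℂ] H₁)) fun A hA => ?_
  refine LinearMap.ext_on (CStarAlgebra.span_nonneg (A := H₂ →L[ℂ] H₂)) fun B hB => ?_
  obtain ⟨a, ha, rfl⟩ := exists_isSelfAdjoint_mul_self hA
  obtain ⟨b, hb, rfl⟩ := exists_isSelfAdjoint_mul_self hB
  exact h a b ha hb

/-- Both sides are bilinear in `A` and `B`, so squares `a²`, `b²` suffice. There `trace_mul_sq`
gives sums of nonnegative terms over product bases, and the sum over the traced-out index is the
defining identity of the partial trace at the vectors `a eᵢ`, `b eⱼ`. -/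
theorem IsPartialTrace₁.trace_mul_tensorOp {T : HTensor₃ H₁ H₂ H₃ →L[ℂ] HTensor₃ H₁ H₂ H₃}
    {σ : HTensor H₂ H₃ →L[ℂ] HTensor H₂ H₃} (h : IsPartialTrace₁ T σ) (hT : T.IsPositive)
    (ht : IsTraceClass T) (hσ : σ.IsPositive) (hσt : IsTraceClass σ)
    (A : H₂ →L[ℂ] H₂) (B : H₃ →L[ℂ] H₃) :
    trace (T * tensorOp (tensorOp 1 A) B) = trace (σ * tensorOp A B) := by
  have key : (tensorOpₗ (HTensor H₁ H₂) H₃ ∘ₗ tensorOpₗ H₁ H₂ 1).compr₂ (traceMul T hT ht)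
      = (tensorOpₗ H₂ H₃).compr₂ (traceMul σ hσ hσt) := by
    refine bilinear_ext_of_sq fun a b ha hb => ?_
    have e : tensorOp (tensorOp (1 : H₁ →L[ℂ] H₁) (a * a)) (b * b)
        = tensorOp (tensorOp 1 a) b * tensorOp (tensorOp 1 a) b := by
      rw [← tensorOp_mul, ← tensorOp_mul, one_mul]
    simp only [LinearMap.compr₂_apply, LinearMap.comp_apply, tensorOpₗ_apply, traceMul_apply]
    rw [e, tensorOp_mul]
    refine trace_mul_sq_eq_of_hasSum hT ht
      (tensorOp_isSelfAdjoint (tensorOp_isSelfAdjoint (.one _) ha) hb) hσ hσt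
      (tensorOp_isSelfAdjoint ha hb)
      (prodBasis (prodBasis (stdBasis H₁) (stdBasis H₂)) (stdBasis H₃))
      (prodBasis (stdBasis H₂) (stdBasis H₃)) (Equiv.prodAssoc _ _ _).symm fun j => ?_
    simp only [prodBasis_apply, Equiv.prodAssoc_symm_apply, tensorOp_tmul]
    exact h (a (stdBasis H₂ j.1)) (a (stdBasis H₂ j.1)) (b (stdBasis H₃ j.2))
      (b (stdBasis H₃ j.2))
  exact LinearMap.congr_fun₂ key A B

theorem IsPartialTrace₂.trace_mul_tensorOp {T : HTensor₃ H₁ H₂ H₃ →L[ℂ] HTensor₃ H₁ H₂ H₃}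
    {σ : HTensor H₁ H₃ →L[ℂ] HTensor H₁ H₃} (h : IsPartialTrace₂ T σ) (hT : T.IsPositive)
    (ht : IsTraceClass T) (hσ : σ.IsPositive) (hσt : IsTraceClass σ)
    (A : H₁ →L[ℂ] H₁) (B : H₃ →L[ℂ] H₃) :
    trace (T * tensorOp (tensorOp A 1) B) = trace (σ * tensorOp A B) := by
  have key : (tensorOpₗ (HTensor H₁ H₂) H₃ ∘ₗ (tensorOpₗ H₁ H₂).flip 1).compr₂ (traceMul T hT ht)
      = (tensorOpₗ H₁ H₃).compr₂ (traceMul σ hσ hσt) := by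
    refine bilinear_ext_of_sq fun a b ha hb => ?_
    have e : tensorOp (tensorOp (a * a) (1 : H₂ →L[ℂ] H₂)) (b * b)
        = tensorOp (tensorOp a 1) b * tensorOp (tensorOp a 1) b := by
      rw [← tensorOp_mul, ← tensorOp_mul, one_mul]
    simp only [LinearMap.compr₂_apply, LinearMap.comp_apply, LinearMap.flip_apply,
      tensorOpₗ_apply, traceMul_apply]
    rw [e, tensorOp_mul]
    -- The reindexing isolates the middle index, which is the one summed out.
    let r : BasisIndex H₂ × BasisIndex H₁ × BasisIndex H₃
        ≃ (BasisIndex H₁ × BasisIndex H₂) × BasisIndex H₃ :=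
      (Equiv.prodAssoc _ _ _).symm.trans ((Equiv.prodComm _ _).prodCongr (Equiv.refl _))
    refine trace_mul_sq_eq_of_hasSum hT ht
      (tensorOp_isSelfAdjoint (tensorOp_isSelfAdjoint ha (.one _)) hb) hσ hσt
      (tensorOp_isSelfAdjoint ha hb)
      (prodBasis (prodBasis (stdBasis H₁) (stdBasis H₂)) (stdBasis H₃))
      (prodBasis (stdBasis H₁) (stdBasis H₃)) r fun j => ?_
    simp only [prodBasis_apply, tensorOp_tmul]
    exact h (a (stdBasis H₁ j.1)) (a (stdBasis H₁ j.1)) (b (stdBasis H₃ j.2))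
      (b (stdBasis H₃ j.2))
  exact LinearMap.congr_fun₂ key A B

theorem IsPartialTrace₃.trace_mul_tensorOp {T : HTensor₃ H₁ H₂ H₃ →L[ℂ] HTensor₃ H₁ H₂ H₃}
    {σ : HTensor H₁ H₂ →L[ℂ] HTensor H₁ H₂} (h : IsPartialTrace₃ T σ) (hT : T.IsPositive)
    (ht : IsTraceClass T) (hσ : σ.IsPositive) (hσt : IsTraceClass σ)
    (A : H₁ →L[ℂ] H₁) (B : H₂ →L[ℂ] H₂) :
    trace (T * tensorOp (tensorOp A B) 1) = trace (σ * tensorOp A B) := by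
  have key : (tensorOpₗ H₁ H₂).compr₂
        (traceMul T hT ht ∘ₗ (tensorOpₗ (HTensor H₁ H₂) H₃).flip 1)
      = (tensorOpₗ H₁ H₂).compr₂ (traceMul σ hσ hσt) := by
    refine bilinear_ext_of_sq fun a b ha hb => ?_
    have e : tensorOp (tensorOp (a * a) (b * b)) (1 : H₃ →L[ℂ] H₃)
        = tensorOp (tensorOp a b) 1 * tensorOp (tensorOp a b) 1 := by
      rw [← tensorOp_mul, ← tensorOp_mul, one_mul]
    simp only [LinearMap.compr₂_apply, LinearMap.comp_apply, LinearMap.flip_apply,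
      tensorOpₗ_apply, traceMul_apply]
    rw [e, tensorOp_mul]
    refine trace_mul_sq_eq_of_hasSum hT ht
      (tensorOp_isSelfAdjoint (tensorOp_isSelfAdjoint ha hb) (.one _)) hσ hσt
      (tensorOp_isSelfAdjoint ha hb)
      (prodBasis (prodBasis (stdBasis H₁) (stdBasis H₂)) (stdBasis H₃))
      (prodBasis (stdBasis H₁) (stdBasis H₂)) (Equiv.prodComm _ _) fun j => ?_
    simp only [prodBasis_apply, Equiv.prodComm_apply, Prod.swap_prod_mk, tensorOp_tmul]
    exact h (a (stdBasis H₁ j.1)) (a (stdBasis H₁ j.1)) (b (stdBasis H₂ j.2))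
      (b (stdBasis H₂ j.2))
  exact LinearMap.congr_fun₂ key A B

end PartialTraceFunctional

/-! ### Exchange of the two factors in a symmetric state. -/

section SymmetricState

variable {H : Type*} [NormedAddCommGroup H] [InnerProductSpace ℂ H] [CompleteSpace H]

theorem IsSymmetricState.trace_mul_tensorOp {ρ : HTensor H H →L[ℂ] HTensor H H}
    (h : IsSymmetricState ρ) (hρ : ρ.IsPositive) (hρt : IsTraceClass ρ) (A B : H →L[ℂ] H) :
    trace (ρ * tensorOp A B) = trace (ρ * tensorOp B A) := by
  have key : (tensorOpₗ H H).compr₂ (traceMul ρ hρ hρt)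
      = (tensorOpₗ H H).flip.compr₂ (traceMul ρ hρ hρt) := by
    refine bilinear_ext_of_sq fun a b ha hb => ?_
    simp only [LinearMap.compr₂_apply, LinearMap.flip_apply, tensorOpₗ_apply, traceMul_apply]
    rw [tensorOp_mul, tensorOp_mul]
    rw [trace_mul_sq hρ hρt (tensorOp_isSelfAdjoint ha hb) (prodBasis (stdBasis H) (stdBasis H)),
      trace_mul_sq hρ hρt (tensorOp_isSelfAdjoint hb ha) (prodBasis (stdBasis H) (stdBasis H)),
      ← (Equiv.prodComm _ _).tsum_eq]
    refine congrArg (fun t : ℝ≥0∞ => (t.toReal : ℂ)) (tsum_congr fun j => ?_)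
    simp only [prodBasis_apply, Equiv.prodComm_apply, Prod.fst_swap, Prod.snd_swap, tensorOp_tmul]
    -- With `ρ` replaced by `V ρ V` on one side only, the self-adjoint `V` passes to the other
    -- argument of the inner product and exchanges the factors.
    conv_rhs => rw [← h]
    rw [← swapOp_tmul]
    exact congrArg (fun z : ℂ => ENNReal.ofReal z.re)
      (ContinuousLinearMap.isSelfAdjoint_iff_isSymmetric.1 swapOp_isSelfAdjoint _ _)
  exact LinearMap.congr_fun₂ key A B

end SymmetricState

end QuantumBell

namespace QuantumBell

/-! ### The Bell inequality for dilated bilinear functionals -/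

section Dilation

/-- The relation makes `(p, q)` proportional to `(s, -r)`. With ratio `k`, `|k| ≤ 1`, the sum is `s
(1 + k) + r (1 - k)`, whose weights are nonnegative and add up to 2. If `|p| > |s|`, the inverse
ratio is used. -/
theorem add_add_add_le_two {p q r s : ℝ} (hp : |p| ≤ 1) (hq : |q| ≤ 1) (hr : |r| ≤ 1)
    (hs : |s| ≤ 1) (h : p * r = -(q * s)) : p + q + r + s ≤ 2 := by
  rw [abs_le] at hp hq hr hs
  have key : ∀ {x y : ℝ}, x ≤ 1 → y ≤ 1 → ∀ {k : ℝ}, |k| ≤ 1 →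
      x * (1 + k) + y * (1 - k) ≤ 2 := fun hx hy k hk => by
    rw [abs_le] at hk
    nlinarith
  rcases le_or_gt |p| |s| with hps | hps
  · rcases eq_or_ne s 0 with rfl | hs0
    · have : p = 0 := by simpa using hps
      linarith
    · have hk : |p / s| ≤ 1 := by
        rw [abs_div]; exact div_le_one_of_le₀ hps (abs_nonneg _)
      have h1 : p = p / s * s := by field_simp
      have h2 : q = -(p / s * r) := by field_simp; linarith
      have := key hs.2 hr.2 hk
      linarith
  · have hp0 : p ≠ 0 := fun h0 => by simp [h0] at hps; linarith [abs_nonneg s]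
    have hk : |s / p| ≤ 1 := by
      rw [abs_div]; exact div_le_one_of_le₀ hps.le (abs_nonneg _)
    have h1 : s = s / p * p := by field_simp
    have h2 : r = -(s / p * q) := by field_simp; linarith
    have := key hp.2 hq.2 hk
    linarith

/-- The relation survives a common change of sign of `p, q` or of `r, s`, which covers every sign
pattern of the absolute values. -/
theorem abs_add_add_abs_add_le_two {p q r s : ℝ} (hp : |p| ≤ 1) (hq : |q| ≤ 1) (hr : |r| ≤ 1)
    (hs : |s| ≤ 1) (h : p * r = -(q * s)) : |p + q| + |r + s| ≤ 2 := by
  have h1 := add_add_add_le_two hp hq hr hs h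
  have h2 := add_add_add_le_two (p := -p) (q := -q) (by rwa [abs_neg]) (by rwa [abs_neg]) hr hs
    (by linarith)
  have h3 := add_add_add_le_two (r := -r) (s := -s) hp hq (by rwa [abs_neg]) (by rwa [abs_neg])
    (by linarith)
  have h4 := add_add_add_le_two (p := -p) (q := -q) (r := -r) (s := -s) (by rwa [abs_neg])
    (by rwa [abs_neg]) (by rwa [abs_neg]) (by rwa [abs_neg]) (by linarith)
  rcases abs_cases (p + q) with h5 | h5 <;> rcases abs_cases (r + s) with h6 | h6 <;> linarith

theorem abs_mul_sub_add_mul_sub_le {α β w₁ w₂ w₃ w₄ s₁ s₂ s₃ s₄ : ℝ} (h₁ : |w₁| ≤ s₁)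
    (h₂ : |w₂| ≤ s₂) (h₃ : |w₃| ≤ s₃) (h₄ : |w₄| ≤ s₄) :
    |α * (w₁ - w₄) + β * (w₂ - w₃)| ≤ |α| * (s₁ + s₄) + |β| * (s₂ + s₃) := by
  refine (abs_add_le _ _).trans (add_le_add ?_ ?_) <;> rw [abs_mul]
  · exact mul_le_mul_of_nonneg_left ((abs_sub _ _).trans (by linarith)) (abs_nonneg _)
  · exact mul_le_mul_of_nonneg_left ((abs_sub _ _).trans (by linarith)) (abs_nonneg _)

variable {R : Type*} [Ring R] [PartialOrder R]

/-- A functional `F` of three operators, additive in each, positive and normalized, dilates the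
functional `G` of two operators if `G X Z = F X 1 Z = F 1 X Z`. -/
structure IsDilation (F : R → R → R → ℝ) (G : R → R → ℝ) : Prop where
  add₁ : ∀ X X' Y Z, F (X + X') Y Z = F X Y Z + F X' Y Z
  add₂ : ∀ X Y Y' Z, F X (Y + Y') Z = F X Y Z + F X Y' Z
  add₃ : ∀ X Y Z Z', F X Y (Z + Z') = F X Y Z + F X Y Z'
  nonneg : ∀ X Y Z, 0 ≤ X → 0 ≤ Y → 0 ≤ Z → 0 ≤ F X Y Z
  one : F 1 1 1 = 1
  left : ∀ X Z, F X 1 Z = G X Z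
  right : ∀ X Z, F 1 X Z = G X Z

theorem IsDilation.abs_sum_le_two [AddLeftMono R] {F : R → R → R → ℝ} {G : R → R → ℝ}
    (h : IsDilation F G)
    {A B : Fin 2 → R} (hA : ∀ n, -1 ≤ A n ∧ A n ≤ 1) (hB : ∀ m, -1 ≤ B m ∧ B m ≤ 1)
    {γ : Fin 2 → Fin 2 → ℝ} (hγ : ∀ n m, |γ n m| ≤ 1)
    (hγ' : γ 0 0 * γ 0 1 = -(γ 1 0 * γ 1 1)) :
    |∑ n : Fin 2, ∑ m : Fin 2, γ n m * G (A n) (B m)| ≤ 2 := by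
  have sub₁ : ∀ X X' Y Z, F (X - X') Y Z = F X Y Z - F X' Y Z := fun X X' Y Z => by
    have := h.add₁ (X - X') X' Y Z
    rw [sub_add_cancel] at this
    linarith
  have sub₂ : ∀ X Y Y' Z, F X (Y - Y') Z = F X Y Z - F X Y' Z := fun X Y Y' Z => by
    have := h.add₂ X (Y - Y') Y' Z
    rw [sub_add_cancel] at this
    linarith
  have sub₃ : ∀ X Y Z Z', F X Y (Z - Z') = F X Y Z - F X Y Z' := fun X Y Z Z' => by
    have := h.add₃ X Y (Z - Z') Z'
    rw [sub_add_cancel] at this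
    linarith
  have plus : ∀ X : R, -1 ≤ X ∧ X ≤ 1 → 0 ≤ 1 + X := fun X hX => by
    simpa using add_le_add_right hX.1 1
  have minus : ∀ X : R, -1 ≤ X ∧ X ≤ 1 → 0 ≤ 1 - X := fun X hX => sub_nonneg.2 hX.2
  -- This is positivity of `F` at `1 + Z` and `1 - Z`.
  have bound : ∀ X Y Z, 0 ≤ X → 0 ≤ Y → -1 ≤ Z ∧ Z ≤ 1 → |F X Y Z| ≤ F X Y 1 :=
    fun X Y Z hX hY hZ => by
      have h1 := h.nonneg X Y (1 + Z) hX hY (plus Z hZ)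
      have h2 := h.nonneg X Y (1 - Z) hX hY (minus Z hZ)
      rw [h.add₃] at h1
      rw [sub₃] at h2
      exact abs_le.2 ⟨by linarith, by linarith⟩
  -- The factor 4 clears the halves in writing `α A₀ ⊗ 1 + β 1 ⊗ A₁` through `α + β` and `α - β` and
  -- then through the products of `1 ± A₀` and `1 ± A₁`.
  have part : ∀ m, |γ 0 m * G (A 0) (B m) + γ 1 m * G (A 1) (B m)| * 4
      ≤ |γ 0 m + γ 1 m| * (F (1 + A 0) (1 + A 1) 1 + F (1 - A 0) (1 - A 1) 1)
        + |γ 0 m - γ 1 m| * (F (1 + A 0) (1 - A 1) 1 + F (1 - A 0) (1 + A 1) 1) := fun m => by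
    refine le_of_eq_of_le ?_ (abs_mul_sub_add_mul_sub_le
      (bound _ _ (B m) (plus _ (hA 0)) (plus _ (hA 1)) (hB m))
      (bound _ _ (B m) (plus _ (hA 0)) (minus _ (hA 1)) (hB m))
      (bound _ _ (B m) (minus _ (hA 0)) (plus _ (hA 1)) (hB m))
      (bound _ _ (B m) (minus _ (hA 0)) (minus _ (hA 1)) (hB m)))
    rw [show (4 : ℝ) = |4| by norm_num, ← abs_mul]
    congr 1
    simp only [h.add₁, h.add₂, sub₁, sub₂, ← h.left (A 0), ← h.right (A 1)]
    ring
  have total : F (1 + A 0) (1 + A 1) 1 + F (1 - A 0) (1 - A 1) 1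
      + (F (1 + A 0) (1 - A 1) 1 + F (1 - A 0) (1 + A 1) 1) = 4 := by
    simp only [h.add₁, h.add₂, sub₁, sub₂, h.one]
    ring
  have hplus : 0 ≤ F (1 + A 0) (1 + A 1) 1 + F (1 - A 0) (1 - A 1) 1 :=
    add_nonneg ((abs_nonneg _).trans (bound _ _ (B 0) (plus _ (hA 0)) (plus _ (hA 1)) (hB 0)))
      ((abs_nonneg _).trans (bound _ _ (B 0) (minus _ (hA 0)) (minus _ (hA 1)) (hB 0)))
  have hminus : 0 ≤ F (1 + A 0) (1 - A 1) 1 + F (1 - A 0) (1 + A 1) 1 :=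
    add_nonneg ((abs_nonneg _).trans (bound _ _ (B 0) (plus _ (hA 0)) (minus _ (hA 1)) (hB 0)))
      ((abs_nonneg _).trans (bound _ _ (B 0) (minus _ (hA 0)) (plus _ (hA 1)) (hB 0)))
  have c1 := abs_add_add_abs_add_le_two (hγ 0 0) (hγ 1 0) (hγ 0 1) (hγ 1 1) hγ'
  -- Changing the sign of both `γ 1 0` and `γ 1 1` leaves their product, hence the relation, intact.
  have c2 := abs_add_add_abs_add_le_two (q := -γ 1 0) (s := -γ 1 1) (hγ 0 0)
    (by rw [abs_neg]; exact hγ 1 0) (hγ 0 1) (by rw [abs_neg]; exact hγ 1 1) (by linarith)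
  rw [← sub_eq_add_neg, ← sub_eq_add_neg] at c2
  have hsum : ∑ n : Fin 2, ∑ m : Fin 2, γ n m * G (A n) (B m)
      = (γ 0 0 * G (A 0) (B 0) + γ 1 0 * G (A 1) (B 0))
        + (γ 0 1 * G (A 0) (B 1) + γ 1 1 * G (A 1) (B 1)) := by
    simp only [Fin.sum_univ_two]
    ring
  rw [hsum]
  have m1 := mul_le_mul_of_nonneg_right c1 hplus
  have m2 := mul_le_mul_of_nonneg_right c2 hminus
  have p0 := part 0
  have p1 := part 1
  have tri := abs_add_le (γ 0 0 * G (A 0) (B 0) + γ 1 0 * G (A 1) (B 0))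
    (γ 0 1 * G (A 0) (B 1) + γ 1 1 * G (A 1) (B 1))
  linarith

end Dilation

/-! ### Expectations as limits of traces -/

section Expectation

open MeasureTheory

variable {Λ : Type*} [MeasurableSpace Λ]
  {H : Type*} [NormedAddCommGroup H] [InnerProductSpace ℂ H] [CompleteSpace H]

/-- The complex measure `B ↦ ⟪x, M(B) y⟫`. -/
noncomputable def POVM.matrixElement (M : POVM Λ H) (x y : H) : ComplexMeasure Λ := by
  classical
  exact
  { measureOf' := fun B => if MeasurableSet B then ⟪x, M.op B y⟫_ℂ else 0
    empty' := by simp [M.op_empty]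
    not_measurable' := fun B hB => if_neg hB
    m_iUnion' := fun s hs hd => by
      simpa only [hs, MeasurableSet.iUnion hs, if_true] using M.hasSum_op s hs hd x y }

theorem POVM.matrixElement_apply (M : POVM Λ H) (x y : H) {B : Set Λ} (hB : MeasurableSet B) :
    M.matrixElement x y B = ⟪x, M.op B y⟫_ℂ :=
  if_pos hB

theorem POVM.sum_op_preimage (M : POVM Λ H) (f : SimpleFunc Λ ℝ) :
    ∑ r ∈ f.range, M.op (f ⁻¹' {r}) = 1 := by
  refine ContinuousLinearMap.ext fun y => ext_inner_left ℂ fun x => ?_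
  -- Finite additivity of the POVM is borrowed from the complex measures of its matrix elements.
  have h := VectorMeasure.of_biUnion_finset (v := M.matrixElement x y) (s := f.range)
    (f := fun r => f ⁻¹' {r})
    (fun r _ s _ hrs => Disjoint.preimage f (Set.disjoint_singleton.2 hrs))
    (fun r _ => f.measurableSet_fiber r)
  have hu : ⋃ r ∈ f.range, f ⁻¹' {r} = Set.univ :=
    Set.eq_univ_of_forall fun z => Set.mem_biUnion (f.mem_range_self z) rfl
  rw [hu, M.matrixElement_apply x y .univ, M.op_univ,
    Finset.sum_congr rfl fun r _ => M.matrixElement_apply x y (f.measurableSet_fiber r)] at h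
  rw [sum_apply, inner_sum, h]

/-- The operator `∫ f(λ) M(dλ)` for a simple function `f`. -/
noncomputable def POVM.simpleOp (M : POVM Λ H) (f : SimpleFunc Λ ℝ) : H →L[ℂ] H :=
  ∑ r ∈ f.range, (r : ℂ) • M.op (f ⁻¹' {r})

theorem POVM.simpleOp_mem_Icc (M : POVM Λ H) {f : SimpleFunc Λ ℝ} (hf : ∀ z, |f z| ≤ 1) :
    -1 ≤ M.simpleOp f ∧ M.simpleOp f ≤ 1 := by
  have hpos : ∀ c : ℝ → ℝ, (∀ r ∈ f.range, 0 ≤ c r) →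
      0 ≤ ∑ r ∈ f.range, (c r : ℂ) • M.op (f ⁻¹' {r}) := fun c hc =>
    Finset.sum_nonneg fun r hr => (ContinuousLinearMap.nonneg_iff_isPositive _).2
      ((M.isPositive _ (f.measurableSet_fiber r)).smul_of_nonneg
        (Complex.zero_le_real.2 (hc r hr)))
  have hr : ∀ r ∈ f.range, |r| ≤ 1 := fun r hr => by
    obtain ⟨z, rfl⟩ := SimpleFunc.mem_range.1 hr
    exact hf z
  -- Since the fibre operators sum to 1, `1 ± simpleOp f` is the combination with the nonnegative
  -- coefficients `1 ± r`.
  have h1 := hpos (fun r => 1 + r) fun r h => by linarith [neg_le_of_abs_le (hr r h)]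
  have h2 := hpos (fun r => 1 - r) fun r h => by linarith [le_of_abs_le (hr r h)]
  simp only [Complex.ofReal_add, Complex.ofReal_sub, Complex.ofReal_one, add_smul, sub_smul,
    one_smul, Finset.sum_add_distrib, Finset.sum_sub_distrib, M.sum_op_preimage] at h1 h2
  exact ⟨neg_le_iff_add_nonneg'.2 h1, sub_nonneg.1 h2⟩

theorem outcomeMeasure_apply {ρ : H →L[ℂ] H} (hρ : IsDensityOperator ρ) (M : POVM Λ H)
    {B : Set Λ} (hB : MeasurableSet B) :
    outcomeMeasure ρ hρ M B = ENNReal.ofReal (trace (ρ * M.op B)).re :=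
  Measure.ofMeasurable_apply B hB

theorem isProbabilityMeasure_outcomeMeasure {ρ : H →L[ℂ] H} (hρ : IsDensityOperator ρ)
    (M : POVM Λ H) : IsProbabilityMeasure (outcomeMeasure ρ hρ M) :=
  ⟨by rw [outcomeMeasure_apply hρ M .univ, M.op_univ, mul_one, hρ.trace_eq_one]; simp⟩

theorem outcomeMeasure_real {ρ : H →L[ℂ] H} (hρ : IsDensityOperator ρ) (M : POVM Λ H)
    {B : Set Λ} (hB : MeasurableSet B) :
    (outcomeMeasure ρ hρ M).real B = (trace (ρ * M.op B)).re := by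
  rw [measureReal_def, outcomeMeasure_apply hρ M hB, ENNReal.toReal_ofReal]
  exact re_trace_mul_nonneg hρ.isPositive hρ.isTraceClass
    ((ContinuousLinearMap.nonneg_iff_isPositive _).2 (M.isPositive B hB))

theorem SimpleFunc.eq_sum_indicator (f : SimpleFunc Λ ℝ) (z : Λ) :
    f z = ∑ r ∈ f.range, r * (f ⁻¹' {r}).indicator 1 z := by
  rw [Finset.sum_eq_single (f z)]
  · simp
  · intro r _ hr
    rw [Set.indicator_of_notMem (fun h => hr h.symm), mul_zero]
  · intro h
    exact absurd (f.mem_range_self z) h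

variable {Λ₁ Λ₂ : Type*} [MeasurableSpace Λ₁] [MeasurableSpace Λ₂]
  {H₁ H₂ : Type*}
  [NormedAddCommGroup H₁] [InnerProductSpace ℂ H₁] [CompleteSpace H₁]
  [NormedAddCommGroup H₂] [InnerProductSpace ℂ H₂] [CompleteSpace H₂]

/-- A product of simple functions is constant on rectangles of fibres, the only events on which the
joint measurement is prescribed. -/
theorem integral_simpleFunc_mul {ρ : HTensor H₁ H₂ →L[ℂ] HTensor H₁ H₂}
    (hρ : IsDensityOperator ρ) {M₁ : POVM Λ₁ H₁} {M₂ : POVM Λ₂ H₂}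
    {M : POVM (Λ₁ × Λ₂) (HTensor H₁ H₂)} (hM : IsJointMeasurement M₁ M₂ M)
    (f : SimpleFunc Λ₁ ℝ) (g : SimpleFunc Λ₂ ℝ) :
    ∫ z, f z.1 * g z.2 ∂(outcomeMeasure ρ hρ M)
      = (trace (ρ * tensorOp (M₁.simpleOp f) (M₂.simpleOp g))).re := by
  have := isProbabilityMeasure_outcomeMeasure hρ M
  have hms : ∀ r s, MeasurableSet ((f ⁻¹' {r}) ×ˢ (g ⁻¹' {s})) := fun r s =>
    (f.measurableSet_fiber r).prod (g.measurableSet_fiber s)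
  have hpt : ∀ z : Λ₁ × Λ₂, f z.1 * g z.2 = ∑ r ∈ f.range, ∑ s ∈ g.range,
      r * s * ((f ⁻¹' {r}) ×ˢ (g ⁻¹' {s})).indicator (1 : Λ₁ × Λ₂ → ℝ) z := fun z => by
    rw [SimpleFunc.eq_sum_indicator f, SimpleFunc.eq_sum_indicator g, Finset.sum_mul_sum]
    refine Finset.sum_congr rfl fun r _ => Finset.sum_congr rfl fun s _ => ?_
    rw [Set.indicator_prod_one]
    ring
  have hint : ∀ r s, Integrable (fun z => r * s *
      ((f ⁻¹' {r}) ×ˢ (g ⁻¹' {s})).indicator (1 : Λ₁ × Λ₂ → ℝ) z) (outcomeMeasure ρ hρ M) :=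
    fun r s => ((integrable_const (1 : ℝ)).indicator (hms r s)).const_mul _
  simp_rw [hpt]
  rw [integral_finsetSum _ fun r _ => integrable_finsetSum _ fun s _ => hint r s]
  have hbil : trace (ρ * tensorOp (M₁.simpleOp f) (M₂.simpleOp g))
      = ∑ r ∈ f.range, ∑ s ∈ g.range,
        (r : ℂ) * ((s : ℂ) * trace (ρ * tensorOp (M₁.op (f ⁻¹' {r})) (M₂.op (g ⁻¹' {s})))) := by
    rw [← traceMul_apply hρ.isPositive hρ.isTraceClass, ← tensorOpₗ_apply, POVM.simpleOp,
      POVM.simpleOp]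
    simp only [map_sum, map_smul, LinearMap.sum_apply, LinearMap.smul_apply, smul_eq_mul,
      Finset.mul_sum, tensorOpₗ_apply, traceMul_apply]
    rw [Finset.sum_comm]
    simp only [mul_left_comm]
  rw [hbil, Complex.re_sum]
  refine Finset.sum_congr rfl fun r _ => ?_
  rw [integral_finsetSum _ fun s _ => hint r s, Complex.re_sum]
  refine Finset.sum_congr rfl fun s _ => ?_
  rw [integral_const_mul, integral_indicator_one (hms r s), outcomeMeasure_real hρ M (hms r s),
    hM _ _ (f.measurableSet_fiber r) (g.measurableSet_fiber s), Complex.re_ofReal_mul,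
    Complex.re_ofReal_mul, mul_assoc]

open Filter Topology in
/-- Bounded outcome functions are approximated by simple functions, and the expectation of their
product by traces. -/
theorem tendsto_re_trace_simpleOp {ρ : HTensor H₁ H₂ →L[ℂ] HTensor H₁ H₂}
    (hρ : IsDensityOperator ρ) {M₁ : POVM Λ₁ H₁} {M₂ : POVM Λ₂ H₂}
    {M : POVM (Λ₁ × Λ₂) (HTensor H₁ H₂)} (hM : IsJointMeasurement M₁ M₂ M)
    {φ : Λ₁ → ℝ} {ψ : Λ₂ → ℝ} {f : ℕ → SimpleFunc Λ₁ ℝ} {g : ℕ → SimpleFunc Λ₂ ℝ}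
    (hf : ∀ k z, |f k z| ≤ 1) (hg : ∀ k z, |g k z| ≤ 1)
    (hφ : ∀ z, Tendsto (fun k => f k z) atTop (𝓝 (φ z)))
    (hψ : ∀ z, Tendsto (fun k => g k z) atTop (𝓝 (ψ z))) :
    Tendsto (fun k => (trace (ρ * tensorOp (M₁.simpleOp (f k)) (M₂.simpleOp (g k)))).re) atTop
      (𝓝 (∫ z, φ z.1 * ψ z.2 ∂(outcomeMeasure ρ hρ M))) := by
  have := isProbabilityMeasure_outcomeMeasure hρ M
  simp_rw [← integral_simpleFunc_mul hρ hM]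
  -- The constant 1 dominates and is integrable, the outcome measure being a probability measure.
  refine tendsto_integral_of_dominated_convergence (fun _ => 1) (fun k => ?_)
    (integrable_const _) (fun k => .of_forall fun z => ?_)
    (.of_forall fun z => (hφ z.1).mul (hψ z.2))
  · exact (((f k).measurable.comp measurable_fst).mul
      ((g k).measurable.comp measurable_snd)).aestronglyMeasurable
  · rw [norm_mul]
    exact mul_le_one₀ (hf k z.1) (norm_nonneg _) (hg k z.2)

theorem exists_simpleFunc_approx {φ : Λ → ℝ} (hφ : Measurable φ) (hb : ∀ z, |φ z| ≤ 1) :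
    ∃ f : ℕ → SimpleFunc Λ ℝ, (∀ k z, |f k z| ≤ 1) ∧
      ∀ z, Filter.Tendsto (fun k => f k z) Filter.atTop (nhds (φ z)) :=
  ⟨hφ.stronglyMeasurable.approxBounded 1,
    fun k z => hφ.stronglyMeasurable.norm_approxBounded_le zero_le_one k z,
    fun z => hφ.stronglyMeasurable.tendsto_approxBounded_of_norm_le (hb z)⟩

end Expectation

end QuantumBell

namespace QuantumBell

/-! ### Density source-operators as dilations -/

section SourceDilation

variable {H : Type*} [NormedAddCommGroup H] [InnerProductSpace ℂ H] [CompleteSpace H]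

/-- The functional `(X, Y, Z) ↦ tr (T (X ⊗ Y ⊗ Z))`. -/
noncomputable def tripleTrace (T : HTensor₃ H H H →L[ℂ] HTensor₃ H H H) (X Y Z : H →L[ℂ] H) : ℝ :=
  (trace (T * tensorOp (tensorOp X Y) Z)).re

section

variable {T : HTensor₃ H H H →L[ℂ] HTensor₃ H H H} (hT : T.IsPositive) (ht : IsTraceClass T)
include hT ht

omit [CompleteSpace H] in
theorem tripleTrace_add₁ (X X' Y Z : H →L[ℂ] H) :
    tripleTrace T (X + X') Y Z = tripleTrace T X Y Z + tripleTrace T X' Y Z := by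
  simp only [tripleTrace, ← traceMul_apply hT ht, ← tensorOpₗ_apply, map_add, LinearMap.add_apply,
    Complex.add_re]

omit [CompleteSpace H] in
theorem tripleTrace_add₂ (X Y Y' Z : H →L[ℂ] H) :
    tripleTrace T X (Y + Y') Z = tripleTrace T X Y Z + tripleTrace T X Y' Z := by
  simp only [tripleTrace, ← traceMul_apply hT ht, ← tensorOpₗ_apply, map_add, LinearMap.add_apply,
    Complex.add_re]

omit [CompleteSpace H] in
theorem tripleTrace_add₃ (X Y Z Z' : H →L[ℂ] H) :
    tripleTrace T X Y (Z + Z') = tripleTrace T X Y Z + tripleTrace T X Y Z' := by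
  simp only [tripleTrace, ← traceMul_apply hT ht, ← tensorOpₗ_apply, map_add, Complex.add_re]

theorem tripleTrace_nonneg {X Y Z : H →L[ℂ] H} (hX : 0 ≤ X) (hY : 0 ≤ Y) (hZ : 0 ≤ Z) :
    0 ≤ tripleTrace T X Y Z :=
  re_trace_mul_nonneg hT ht (tensorOp_nonneg (tensorOp_nonneg hX hY) hZ)

end

variable {ρ : HTensor H H →L[ℂ] HTensor H H} {T : HTensor₃ H H H →L[ℂ] HTensor₃ H H H}

theorem IsSourceOperator₁₁₂.isDilation (hρ : IsDensityOperator ρ) (h : IsSourceOperator₁₁₂ ρ T)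
    (hT : T.IsPositive) :
    IsDilation (tripleTrace T) fun A B => (trace (ρ * tensorOp A B)).re where
  add₁ := tripleTrace_add₁ hT h.isTraceClass
  add₂ := tripleTrace_add₂ hT h.isTraceClass
  add₃ := tripleTrace_add₃ hT h.isTraceClass
  nonneg _ _ _ := tripleTrace_nonneg hT h.isTraceClass
  one := by
    rw [tripleTrace, h.partialTrace₁.trace_mul_tensorOp hT h.isTraceClass hρ.isPositive
      hρ.isTraceClass, tensorOp_one, mul_one, hρ.trace_eq_one, Complex.one_re]
  left X Z := congrArg Complex.re (h.partialTrace₂.trace_mul_tensorOp hT h.isTraceClass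
    hρ.isPositive hρ.isTraceClass X Z)
  right X Z := congrArg Complex.re (h.partialTrace₁.trace_mul_tensorOp hT h.isTraceClass
    hρ.isPositive hρ.isTraceClass X Z)

/-- Here Bob's factor is the doubled one: the arguments are permuted cyclically so that places 2 and
3 come first, and `G` takes Bob's operator first. -/
theorem IsSourceOperator₁₂₂.isDilation (hρ : IsDensityOperator ρ) (h : IsSourceOperator₁₂₂ ρ T)
    (hT : T.IsPositive) :
    IsDilation (fun X Y Z => tripleTrace T Z X Y) fun A B => (trace (ρ * tensorOp B A)).re where
  add₁ _ _ _ _ := tripleTrace_add₂ hT h.isTraceClass _ _ _ _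
  add₂ _ _ _ _ := tripleTrace_add₃ hT h.isTraceClass _ _ _ _
  add₃ _ _ _ _ := tripleTrace_add₁ hT h.isTraceClass _ _ _ _
  nonneg _ _ _ hX hY hZ := tripleTrace_nonneg hT h.isTraceClass hZ hX hY
  one := by
    rw [tripleTrace, h.partialTrace₂.trace_mul_tensorOp hT h.isTraceClass hρ.isPositive
      hρ.isTraceClass, tensorOp_one, mul_one, hρ.trace_eq_one, Complex.one_re]
  left X Z := congrArg Complex.re (h.partialTrace₃.trace_mul_tensorOp hT h.isTraceClass
    hρ.isPositive hρ.isTraceClass Z X)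
  right X Z := congrArg Complex.re (h.partialTrace₂.trace_mul_tensorOp hT h.isTraceClass
    hρ.isPositive hρ.isTraceClass Z X)

/-- Symmetric DSO states and Bell class states can be dilated on either side. -/
theorem IsDSOState.exists_isDilation (h : IsDSOState ρ)
    (hρ : IsSymmetricState ρ ∨ IsBellClass ρ) :
    (∃ F, IsDilation F fun A B : H →L[ℂ] H => (trace (ρ * tensorOp A B)).re) ∧
      ∃ F, IsDilation F fun A B : H →L[ℂ] H => (trace (ρ * tensorOp B A)).re := by
  obtain hs | ⟨-, T, h1, h2, hT⟩ := hρ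
  -- By symmetry the two functionals coincide, so a dilation in either direction serves for both.
  · have hG : (fun A B : H →L[ℂ] H => (trace (ρ * tensorOp B A)).re)
        = fun A B => (trace (ρ * tensorOp A B)).re := by
      funext A B
      rw [hs.trace_mul_tensorOp h.1.isPositive h.1.isTraceClass]
    rcases h.2 with ⟨T, hT, hT'⟩ | ⟨T, hT, hT'⟩
    · have := hT.isDilation h.1 hT'
      exact ⟨⟨_, this⟩, _, hG ▸ this⟩
    · have := hT.isDilation h.1 hT'
      exact ⟨⟨_, hG ▸ this⟩, _, this⟩
  · exact ⟨⟨_, h1.isDilation h.1 hT⟩, _, h2.isDilation h.1 hT⟩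

theorem IsDSOState.abs_sum_trace_le_two (h : IsDSOState ρ)
    (hρ : IsSymmetricState ρ ∨ IsBellClass ρ) {γ : Fin 2 → Fin 2 → ℝ} (hγ : ∀ n m, |γ n m| ≤ 1)
    (hγ' : γ 0 0 * γ 0 1 = -(γ 1 0 * γ 1 1) ∨ γ 0 0 * γ 1 0 = -(γ 0 1 * γ 1 1))
    {A B : Fin 2 → H →L[ℂ] H} (hA : ∀ n, -1 ≤ A n ∧ A n ≤ 1) (hB : ∀ m, -1 ≤ B m ∧ B m ≤ 1) :
    |∑ n : Fin 2, ∑ m : Fin 2, γ n m * (trace (ρ * tensorOp (A n) (B m))).re| ≤ 2 := by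
  obtain ⟨⟨F, hF⟩, F', hF'⟩ := h.exists_isDilation hρ
  rcases hγ' with hγ' | hγ'
  · exact hF.abs_sum_le_two hA hB hγ hγ'
  -- The parties exchange roles, with transposed coefficients and the dilation on Bob's side.
  · rw [Finset.sum_comm]
    exact hF'.abs_sum_le_two (γ := fun m n => γ n m) hB hA (fun m n => hγ n m) hγ'

end SourceDilation

end QuantumBell

/-! ### Passage to the limit from simple functions to the outcomes themselves. -/

theorem theorem6 {H : Type*} [NormedAddCommGroup H] [InnerProductSpace ℂ H] [CompleteSpace H]
    [TopologicalSpace.SeparableSpace H]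
    (γ : Fin 2 → Fin 2 → ℝ) (hγ : ∀ n m, |γ n m| ≤ 1)
    (hγ' : γ 0 0 * γ 0 1 = -(γ 1 0 * γ 1 1) ∨ γ 0 0 * γ 1 0 = -(γ 0 1 * γ 1 1))
    (ρ : QuantumBell.HTensor H H →L[ℂ] QuantumBell.HTensor H H)
    (hDSO : QuantumBell.IsDSOState ρ)
    (hρ' : QuantumBell.IsSymmetricState ρ ∨ QuantumBell.IsBellClass ρ)
    (Λ₁ Λ₂ : Fin 2 → Set ℝ)
    (hΛ₁ : ∀ n, ∀ x ∈ Λ₁ n, |x| ≤ 1) (hΛ₂ : ∀ m, ∀ x ∈ Λ₂ m, |x| ≤ 1)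
    (M₁ : ∀ n, QuantumBell.POVM (Λ₁ n) H) (M₂ : ∀ m, QuantumBell.POVM (Λ₂ m) H)
    (M : ∀ n m, QuantumBell.POVM (Λ₁ n × Λ₂ m) (QuantumBell.HTensor H H))
    (hM : ∀ n m, QuantumBell.IsJointMeasurement (M₁ n) (M₂ m) (M n m)) :
    |∑ n : Fin 2, ∑ m : Fin 2, γ n m * QuantumBell.productExpectation ρ hDSO.1 (M n m)| ≤ 2 := by
  -- The approximants depend only on the party's own setting, so at each stage the same four
  -- operators enter all four traces.
  choose f hf hf' using fun n => QuantumBell.exists_simpleFunc_approx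
    (φ := ((↑) : Λ₁ n → ℝ)) measurable_subtype_coe fun z => hΛ₁ n z z.2
  choose g hg hg' using fun m => QuantumBell.exists_simpleFunc_approx
    (φ := ((↑) : Λ₂ m → ℝ)) measurable_subtype_coe fun z => hΛ₂ m z z.2
  have hlim := (tendsto_finsetSum Finset.univ fun n _ => tendsto_finsetSum Finset.univ fun m _ =>
    (QuantumBell.tendsto_re_trace_simpleOp hDSO.1 (hM n m) (hf n) (hg m) (hf' n)
      (hg' m)).const_mul (γ n m)).abs
  exact le_of_tendsto hlim (.of_forall fun k => hDSO.abs_sum_trace_le_two hρ' hγ hγ'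
    (fun n => (M₁ n).simpleOp_mem_Icc (hf n k)) (fun m => (M₂ m).simpleOp_mem_Icc (hg m k)))
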